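/- Let $\theta\in(0,\pi/4]$ and let $\alpha,\beta,\gamma>0$ be real with $\alpha^2+\beta^2+\gamma^2=1$. Alice (holding qubits $A,A'$), Bob (holding $B,B'$) and the Bank (holding $K$) share the five-qubit state $$\bigl(\cos\theta\,|00\rangle+\sin\theta\,|11\rangle\bigr)_{AB}\otimes\bigl(\alpha|001\rangle+\beta|010\rangle+\gamma|100\rangle\bigr)_{A'B'K}.$$ The Bank measures $K$ in the Hadamard basis $|\pm\rangle=(|0\rangle\pm|1\rangle)/\sqrt2$ and broadcasts the outcome. Say that deterministic Bell-pair restoration on $AB$ is possible if, for each outcome that occurs with non-zero probability, there is a protocol of local operations and classical communication (LOCC) between Alice and Bob, with finitely many rounds and possibly depending on the outcome, which with certainty transforms the corresponding normalized post-measurement state of $AA'BB'$ into a state whose reduced state on $AB$ is the Bell state $(|00\rangle+|11\rangle)/\sqrt2$; arbitrary finite-dimensional local ancillas and leftover local systems are allowed. Then deterministic Bell-pair restoration on $AB$ is possible if and only if $$4\beta^2\gamma^2\ \ge\ 1-\tan^4\theta .$$ -/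

import Mathlib

open scoped Matrix Kronecker

noncomputable section

namespace AssistedTeleportation

/-! ### Local operations and classical communication

Operators on a bipartite system whose Alice part has basis `a` and whose Bob part has basis `b`
are matrices indexed by `a × b`. -/

/-- Alice applies the Kraus operator `K` to her part of `ρ`: `(K ⊗ 1) ρ (K ⊗ 1)†`. -/
def aliceAct {a b a' : Type} [Fintype a] [Fintype b] [DecidableEq b]
    (K : Matrix a' a ℂ) (ρ : Matrix (a × b) (a × b) ℂ) : Matrix (a' × b) (a' × b) ℂ :=
  (K ⊗ₖ (1 : Matrix b b ℂ)) * ρ * (K ⊗ₖ (1 : Matrix b b ℂ))ᴴ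

/-- Bob applies the Kraus operator `K` to his part of `ρ`: `(1 ⊗ K) ρ (1 ⊗ K)†`. -/
def bobAct {a b b' : Type} [Fintype a] [DecidableEq a] [Fintype b]
    (K : Matrix b' b ℂ) (ρ : Matrix (a × b) (a × b) ℂ) : Matrix (a × b') (a × b') ℂ :=
  ((1 : Matrix a a ℂ) ⊗ₖ K) * ρ * ((1 : Matrix a a ℂ) ⊗ₖ K)ᴴ

/-- `IsLOCC Λ` says that `Λ`, from operators on `a × b` to operators on `c × d`, is implemented by
a protocol of local operations and classical communication with finitely many rounds.
In each round one of the two parties measures her or his own part with Kraus operators `K i`,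
`∑ i, (K i)† K i = 1` (local unitaries, added ancillas and discarded local systems are special
cases), and announces the outcome `i`; the rest of the protocol, `Λ i`, may depend on `i`. -/
inductive IsLOCC {c d : Type} [Fintype c] [DecidableEq c] [Fintype d] [DecidableEq d] :
    ∀ {a b : Type} [Fintype a] [DecidableEq a] [Fintype b] [DecidableEq b],
      (Matrix (a × b) (a × b) ℂ → Matrix (c × d) (c × d) ℂ) → Prop
  | done : IsLOCC (a := c) (b := d) (fun ρ => ρ)
  | alice {a b : Type} [Fintype a] [DecidableEq a] [Fintype b] [DecidableEq b] {r : ℕ}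
      {a' : Fin r → Type} [∀ i, Fintype (a' i)] [∀ i, DecidableEq (a' i)]
      (K : ∀ i, Matrix (a' i) a ℂ)
      (hK : ∑ i, (K i)ᴴ * K i = 1)
      (Λ : ∀ i, Matrix (a' i × b) (a' i × b) ℂ → Matrix (c × d) (c × d) ℂ)
      (hΛ : ∀ i, IsLOCC (Λ i)) :
      IsLOCC (a := a) (b := b) (fun ρ => ∑ i, Λ i (aliceAct (K i) ρ))
  | bob {a b : Type} [Fintype a] [DecidableEq a] [Fintype b] [DecidableEq b] {r : ℕ}
      {b' : Fin r → Type} [∀ i, Fintype (b' i)] [∀ i, DecidableEq (b' i)]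
      (K : ∀ i, Matrix (b' i) b ℂ)
      (hK : ∑ i, (K i)ᴴ * K i = 1)
      (Λ : ∀ i, Matrix (a × b' i) (a × b' i) ℂ → Matrix (c × d) (c × d) ℂ)
      (hΛ : ∀ i, IsLOCC (Λ i)) :
      IsLOCC (a := a) (b := b) (fun ρ => ∑ i, Λ i (bobAct (K i) ρ))

/-! ### Registers and states -/

/-- Computational basis of one qubit. -/
abbrev Qubit : Type := Fin 2

/-- Alice holds the registers `A, A'`, in this order. -/
abbrev AliceReg : Type := Qubit × Qubit

/-- Bob holds the registers `B, B'`, in this order. -/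
abbrev BobReg : Type := Qubit × Qubit

/-- The operator `|v⟩⟨v|`. -/
def ketBra {n : Type} (v : n → ℂ) : Matrix n n ℂ := Matrix.vecMulVec v (star v)

/-- The imperfect link `cos θ |00⟩ + sin θ |11⟩` on `A, B`. -/
def linkKet (θ : ℝ) : Qubit × Qubit → ℂ :=
  (Real.cos θ : ℂ) • Pi.single (0, 0) 1 + (Real.sin θ : ℂ) • Pi.single (1, 1) 1

/-- The Bell state `(|00⟩ + |11⟩)/√2` on `A, B`. -/
def bellKet : Qubit × Qubit → ℂ :=
  ((1 / Real.sqrt 2 : ℝ) : ℂ) • (Pi.single (0, 0) 1 + Pi.single (1, 1) 1)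

/-- The Bank's state `α |001⟩ + β |010⟩ + γ |100⟩` on `A', B', K`. -/
def wKet (α β γ : ℝ) : Qubit × Qubit × Qubit → ℂ :=
  (α : ℂ) • Pi.single (0, 0, 1) 1 + (β : ℂ) • Pi.single (0, 1, 0) 1
    + (γ : ℂ) • Pi.single (1, 0, 0) 1

/-- The product of a link state on `A, B` and a Bank state on `A', B', K`, as a vector on
`(AA' BB') K`. -/
def globalKet (φ : Qubit × Qubit → ℂ) (Ω : Qubit × Qubit × Qubit → ℂ) :
    (AliceReg × BobReg) × Qubit → ℂ :=
  fun x => φ (x.1.1.1, x.1.2.1) * Ω (x.1.1.2, x.1.2.2, x.2)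

/-! ### The Bank's measurement and deterministic restoration -/

/-- The Hadamard basis of a qubit: `|+⟩` for the outcome `0` and `|-⟩` for the outcome `1`. -/
def hadamardKet : Fin 2 → Qubit → ℂ :=
  ![((1 / Real.sqrt 2 : ℝ) : ℂ) • (Pi.single 0 1 + Pi.single 1 1),
    ((1 / Real.sqrt 2 : ℝ) : ℂ) • (Pi.single 0 1 - Pi.single 1 1)]

/-- The unnormalized state `(1 ⊗ ⟨v|) Ψ` of `AA' BB'` when the Bank finds `K` in the state `v`. -/
def branchKet (Ψ : (AliceReg × BobReg) × Qubit → ℂ) (v : Qubit → ℂ) : AliceReg × BobReg → ℂ :=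
  fun x => ∑ k, star (v k) * Ψ (x, k)

/-- The probability that the Bank finds `K` in the state `v`. -/
def branchProb (Ψ : (AliceReg × BobReg) × Qubit → ℂ) (v : Qubit → ℂ) : ℝ :=
  ∑ x, ‖branchKet Ψ v x‖ ^ 2

/-- The normalized density operator of `AA' BB'` conditional on the Bank finding `K` in `v`. -/
def conditionalState (Ψ : (AliceReg × BobReg) × Qubit → ℂ) (v : Qubit → ℂ) :
    Matrix (AliceReg × BobReg) (AliceReg × BobReg) ℂ :=
  ((branchProb Ψ v)⁻¹ : ℂ) • ketBra (branchKet Ψ v)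

/-- The reduced operator on `A, B`: partial trace over the leftover registers `ja` and `jb` of
Alice and Bob. -/
def reduceAB {ja jb : Type} [Fintype ja] [Fintype jb]
    (ρ : Matrix ((Qubit × ja) × (Qubit × jb)) ((Qubit × ja) × (Qubit × jb)) ℂ) :
    Matrix (Qubit × Qubit) (Qubit × Qubit) ℂ :=
  fun x y => ∑ i, ∑ j, ρ ((x.1, i), (x.2, j)) ((y.1, i), (y.2, j))

/-- Alice and Bob can turn `ρ` by LOCC, with certainty, into a state whose registers `A, B` are in
the Bell state, with arbitrary leftover systems. -/
def CanRestoreBell (ρ : Matrix (AliceReg × BobReg) (AliceReg × BobReg) ℂ) : Prop :=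
  ∃ (m n : ℕ) (Λ : Matrix (AliceReg × BobReg) (AliceReg × BobReg) ℂ →
      Matrix ((Qubit × Fin m) × (Qubit × Fin n)) ((Qubit × Fin m) × (Qubit × Fin n)) ℂ),
    IsLOCC Λ ∧ reduceAB (Λ ρ) = ketBra bellKet

/-- Deterministic restoration when the Bank measures `K` in the orthonormal basis `v` and
broadcasts the outcome: for every outcome `s` that occurs, Alice and Bob have an LOCC protocol,
which may depend on `s`, that restores the Bell pair on `A, B`. -/
def BankMeasuresRestorable (Ψ : (AliceReg × BobReg) × Qubit → ℂ) (v : Fin 2 → Qubit → ℂ) : Prop :=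
  ∀ s, branchProb Ψ (v s) ≠ 0 → CanRestoreBell (conditionalState Ψ (v s))

end AssistedTeleportation

end

noncomputable section

namespace AssistedTeleportation

/-! ### Pure states as coefficient matrices -/

/-! Write a pure state as a coefficient matrix `Ψ`, rows for Alice and columns for Bob. Its squared
singular values are the Schmidt coefficients, and `‖Ψ‖ ^ 2`, in the l2 operator norm, is the
largest. For the states at hand, restoration is possible exactly when the largest is at most 1/2.

Necessity: summed over branches, the largest coefficients of the unnormalized branch states cannot
decrease under LOCC (`IsLOCC.exists_pure_decomposition`), while an ensemble carrying a Bell pair has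
sum at most 1/2 (`sum_norm_sq_le_half_of_reduceAB_eq_bell`).

Sufficiency: the spectrum is then a mixture of rearrangements of (1/2, 1/2, 0, 0)
(`canRestoreBell_of_gram_eq_diagonal`). Each term is one outcome of a measurement by Alice, after
which Bob applies a unitary (`canRestoreBell_of_gram_eq`).

Here the largest coefficient is `cos θ ^ 2 * l`, where `m ≤ l`, `l + m = 1` and `l * m = β ^ 2 * γ ^
2`. -/

/-- The vector on `a × b` with coefficient matrix `Ψ`. -/
def vec {a b : Type} (Ψ : Matrix a b ℂ) : a × b → ℂ := fun x => Ψ x.1 x.2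

theorem mul_ketBra_mul_conjTranspose {m n : Type} [Fintype n] (L : Matrix m n ℂ) (v : n → ℂ) :
    L * ketBra v * Lᴴ = ketBra (L *ᵥ v) := by
  rw [ketBra, ketBra, Matrix.mul_vecMulVec, Matrix.vecMulVec_mul, Matrix.star_mulVec]

theorem ketBra_smul {n : Type} (c : ℝ) (v : n → ℂ) :
    ketBra ((c : ℂ) • v) = ((c ^ 2 : ℝ) : ℂ) • ketBra v := by
  ext i j
  simp only [ketBra, Matrix.vecMulVec_apply, Pi.smul_apply, Pi.star_apply, smul_eq_mul,
    Matrix.smul_apply, star_mul', Complex.star_def, Complex.conj_ofReal]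
  push_cast
  ring

theorem aliceAct_ketBra_vec {a b a' : Type} [Fintype a] [Fintype b] [DecidableEq b]
    (K : Matrix a' a ℂ) (Ψ : Matrix a b ℂ) :
    aliceAct K (ketBra (vec Ψ)) = ketBra (vec (K * Ψ)) := by
  rw [aliceAct, mul_ketBra_mul_conjTranspose]
  congr 1
  ext x
  simp [vec, Matrix.mulVec, dotProduct, Fintype.sum_prod_type, Matrix.mul_apply,
    Matrix.one_apply]

/-- Bob acts on the column index, so his operator enters transposed, without conjugation. -/
theorem bobAct_ketBra_vec {a b b' : Type} [Fintype a] [DecidableEq a] [Fintype b]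
    (K : Matrix b' b ℂ) (Ψ : Matrix a b ℂ) :
    bobAct K (ketBra (vec Ψ)) = ketBra (vec (Ψ * Kᵀ)) := by
  rw [bobAct, mul_ketBra_mul_conjTranspose]
  congr 1
  ext x
  rw [Matrix.mulVec, dotProduct, Fintype.sum_prod_type, Finset.sum_eq_single x.1]
  · simp [vec, Matrix.mul_apply, mul_comm]
  · intro i _ hi
    simp [Matrix.one_apply_ne hi.symm]
  · simp

/-! ### The largest Schmidt coefficient under LOCC -/

open scoped Matrix.Norms.L2Operator

theorem sum_norm_sq_mulVec_le {m n : Type} [Fintype m] [Fintype n] [DecidableEq n]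
    (A : Matrix m n ℂ) (w : n → ℂ) :
    ∑ i, ‖(A *ᵥ w) i‖ ^ 2 ≤ ‖A‖ ^ 2 * ∑ j, ‖w j‖ ^ 2 := by
  have h := Matrix.l2_opNorm_mulVec A (WithLp.toLp 2 w)
  have h2 := pow_le_pow_left₀ (norm_nonneg _) h 2
  rwa [mul_pow, EuclideanSpace.norm_sq_eq, EuclideanSpace.norm_sq_eq] at h2

theorem norm_sq_le_of_sum_norm_sq_mulVec_le {m n : Type} [Fintype m] [Fintype n] [DecidableEq n]
    (A : Matrix m n ℂ) {C : ℝ} (hC : 0 ≤ C)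
    (h : ∀ w : n → ℂ, ∑ i, ‖(A *ᵥ w) i‖ ^ 2 ≤ C * ∑ j, ‖w j‖ ^ 2) : ‖A‖ ^ 2 ≤ C := by
  have h1 : ‖A‖ ≤ √C := by
    rw [Matrix.l2_opNorm_def]
    refine ContinuousLinearMap.opNorm_le_bound _ (Real.sqrt_nonneg _) fun x => ?_
    refine le_of_sq_le_sq ?_ (by positivity)
    rw [mul_pow, Real.sq_sqrt hC, EuclideanSpace.norm_sq_eq, EuclideanSpace.norm_sq_eq]
    exact h x.ofLp
  calc ‖A‖ ^ 2 ≤ √C ^ 2 := pow_le_pow_left₀ (norm_nonneg _) h1 2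
    _ = C := Real.sq_sqrt hC

theorem ofReal_sum_norm_sq {n : Type} [Fintype n] (v : n → ℂ) :
    ((∑ i, ‖v i‖ ^ 2 : ℝ) : ℂ) = star v ⬝ᵥ v := by
  simp [dotProduct, Complex.conj_mul']

theorem sum_norm_sq_kraus {a : Type} [Fintype a] [DecidableEq a] {r : ℕ} {a' : Fin r → Type}
    [∀ i, Fintype (a' i)] (K : ∀ i, Matrix (a' i) a ℂ) (hK : ∑ i, (K i)ᴴ * K i = 1) (v : a → ℂ) :
    ∑ k, ∑ i, ‖(K k *ᵥ v) i‖ ^ 2 = ∑ i, ‖v i‖ ^ 2 := by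
  apply Complex.ofReal_injective
  rw [Complex.ofReal_sum, ofReal_sum_norm_sq]
  simp_rw [ofReal_sum_norm_sq, Matrix.star_mulVec, ← Matrix.dotProduct_mulVec,
    Matrix.mulVec_mulVec]
  rw [← dotProduct_sum, ← Matrix.sum_mulVec, hK, Matrix.one_mulVec]

/-- Completeness splits the squared length of `Ψ *ᵥ w` among the outcomes. Different outcomes may be
maximized by different `w`, hence only an inequality. -/
theorem norm_sq_le_sum_kraus_mul {a b : Type} [Fintype a] [DecidableEq a] [Fintype b]
    [DecidableEq b] {r : ℕ} {a' : Fin r → Type}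
    [∀ i, Fintype (a' i)] (K : ∀ i, Matrix (a' i) a ℂ) (hK : ∑ i, (K i)ᴴ * K i = 1)
    (Ψ : Matrix a b ℂ) : ‖Ψ‖ ^ 2 ≤ ∑ k, ‖K k * Ψ‖ ^ 2 := by
  refine norm_sq_le_of_sum_norm_sq_mulVec_le _ (by positivity) fun w => ?_
  rw [← sum_norm_sq_kraus K hK, Finset.sum_mul]
  refine Finset.sum_le_sum fun k _ => ?_
  rw [Matrix.mulVec_mulVec]
  exact sum_norm_sq_mulVec_le _ _

/-- Taking adjoints reduces this to Alice's case, with the entrywise conjugates `(K k)ᴴᵀ` as Kraus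
operators. -/
theorem norm_sq_le_sum_mul_kraus {a b : Type} [Fintype a] [DecidableEq a] [Fintype b]
    [DecidableEq b] {r : ℕ} {b' : Fin r → Type}
    [∀ i, Fintype (b' i)] [∀ i, DecidableEq (b' i)] (K : ∀ i, Matrix (b' i) b ℂ)
    (hK : ∑ i, (K i)ᴴ * K i = 1)
    (Ψ : Matrix a b ℂ) : ‖Ψ‖ ^ 2 ≤ ∑ k, ‖Ψ * (K k)ᵀ‖ ^ 2 := by
  have h1 : ∑ k, ((K k)ᴴᵀ)ᴴ * (K k)ᴴᵀ = 1 := by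
    have h2 := congrArg Matrix.transpose hK
    rw [Matrix.transpose_sum, Matrix.transpose_one] at h2
    refine Eq.trans (Finset.sum_congr rfl fun k _ => ?_) h2
    rw [Matrix.transpose_mul]
    congr 1
    ext
    simp
  have h := norm_sq_le_sum_kraus_mul (fun k => (K k)ᴴᵀ) h1 Ψᴴ
  rw [Matrix.l2_opNorm_conjTranspose] at h
  refine h.trans_eq (Finset.sum_congr rfl fun k _ => ?_)
  rw [← Matrix.l2_opNorm_conjTranspose (Ψ * (K k)ᵀ), Matrix.conjTranspose_mul]
  rfl

/-- An LOCC protocol turns a pure state into a mixture of pure states whose unnormalized largest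
Schmidt coefficients add up to at least the original one. -/
theorem IsLOCC.exists_pure_decomposition {c d : Type} [Fintype c] [DecidableEq c] [Fintype d]
    [DecidableEq d] {a b : Type} [Fintype a] [DecidableEq a] [Fintype b] [DecidableEq b]
    {Λ : Matrix (a × b) (a × b) ℂ → Matrix (c × d) (c × d) ℂ} (hΛ : IsLOCC Λ) (Ψ : Matrix a b ℂ) :
    ∃ (ι : Type) (_ : Fintype ι) (Φ : ι → Matrix c d ℂ),
      Λ (ketBra (vec Ψ)) = ∑ l, ketBra (vec (Φ l)) ∧ ‖Ψ‖ ^ 2 ≤ ∑ l, ‖Φ l‖ ^ 2 := by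
  induction hΛ with
  | done => exact ⟨Unit, inferInstance, fun _ => Ψ, by simp, by simp⟩
  | alice K hK Λ _ ih =>
    choose ι hι Φ h1 h2 using fun i => ih i (K i * Ψ)
    refine ⟨Σ i, ι i, inferInstance, fun l => Φ l.1 l.2, ?_, ?_⟩
    · simp_rw [aliceAct_ketBra_vec, h1, Fintype.sum_sigma]
    · rw [Fintype.sum_sigma]
      exact (norm_sq_le_sum_kraus_mul K hK Ψ).trans (Finset.sum_le_sum fun i _ => h2 i)
  | bob K hK Λ _ ih =>
    choose ι hι Φ h1 h2 using fun i => ih i (Ψ * (K i)ᵀ)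
    refine ⟨Σ i, ι i, inferInstance, fun l => Φ l.1 l.2, ?_, ?_⟩
    · simp_rw [bobAct_ketBra_vec, h1, Fintype.sum_sigma]
    · rw [Fintype.sum_sigma]
      exact (norm_sq_le_sum_mul_kraus K hK Ψ).trans (Finset.sum_le_sum fun i _ => h2 i)

/-! ### Schmidt coefficients of ensembles carrying a Bell pair -/

theorem norm_sq_one_kronecker_le {k m n : Type} [Fintype k] [DecidableEq k] [Fintype m] [Fintype n]
    [DecidableEq n] (χ : Matrix m n ℂ) :
    ‖(1 : Matrix k k ℂ) ⊗ₖ χ‖ ^ 2 ≤ ∑ i, ∑ j, ‖χ i j‖ ^ 2 := by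
  refine norm_sq_le_of_sum_norm_sq_mulVec_le _ (by positivity) fun w => ?_
  rw [Fintype.sum_prod_type, Fintype.sum_prod_type, Finset.mul_sum]
  refine Finset.sum_le_sum fun x _ => ?_
  rw [Finset.sum_mul]
  refine Finset.sum_le_sum fun i _ => ?_
  have h : (((1 : Matrix k k ℂ) ⊗ₖ χ) *ᵥ w) (x, i) = ∑ j, χ i j * w (x, j) := by
    rw [Matrix.mulVec, dotProduct, Fintype.sum_prod_type, Finset.sum_eq_single x]
    · simp
    · intro y _ hy
      simp [Matrix.one_apply_ne hy.symm]
    · simp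
  rw [h]
  calc ‖∑ j, χ i j * w (x, j)‖ ^ 2 ≤ (∑ j, ‖χ i j‖ * ‖w (x, j)‖) ^ 2 := by
        refine pow_le_pow_left₀ (norm_nonneg _) ((norm_sum_le _ _).trans_eq ?_) 2
        simp_rw [norm_mul]
    _ ≤ _ := Finset.sum_mul_sq_le_sq_mul_sq _ _ _

theorem reduceAB_sum_ketBra_vec {m n : ℕ} {ι : Type} [Fintype ι]
    (Φ : ι → Matrix (Qubit × Fin m) (Qubit × Fin n) ℂ) (x y : Qubit × Qubit) :
    reduceAB (∑ l, ketBra (vec (Φ l))) x y = ∑ l, ∑ i, ∑ j,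
      Φ l (x.1, i) (x.2, j) * star (Φ l (y.1, i) (y.2, j)) := by
  simp only [reduceAB, Matrix.sum_apply, ketBra, vec, Matrix.vecMulVec_apply, Pi.star_apply]
  simp_rw [Finset.sum_comm (t := (Finset.univ : Finset ι))]

theorem inv_sqrt_two_mul_self :
    ((1 / Real.sqrt 2 : ℝ) : ℂ) * ((1 / Real.sqrt 2 : ℝ) : ℂ) = 1 / 2 := by
  rw [← Complex.ofReal_mul, div_mul_div_comm, Real.mul_self_sqrt (by norm_num)]
  norm_num

theorem ketBra_bellKet_apply (x y : Qubit × Qubit) :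
    ketBra bellKet x y = if x.1 = x.2 ∧ y.1 = y.2 then 1 / 2 else 0 := by
  have h : ∀ x : Qubit × Qubit, bellKet x =
      if x.1 = x.2 then ((1 / Real.sqrt 2 : ℝ) : ℂ) else 0 := by
    rintro ⟨i, j⟩
    fin_cases i <;> fin_cases j <;> simp [bellKet]
  rw [ketBra, Matrix.vecMulVec_apply, Pi.star_apply, h, h, ← inv_sqrt_two_mul_self]
  by_cases h1 : x.1 = x.2 <;> by_cases h2 : y.1 = y.2 <;> simp [h1, h2]

theorem eq_zero_of_sum_mul_star_eq_zero {ι : Type} [Fintype ι] {m n : ℕ}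
    (f : ι → Fin m → Fin n → ℂ) (h : ∑ l, ∑ i, ∑ j, f l i j * star (f l i j) = 0)
    (l : ι) (i : Fin m) (j : Fin n) : f l i j = 0 := by
  have h' : ∑ l, ∑ i, ∑ j, ‖f l i j‖ ^ 2 = 0 := by
    apply Complex.ofReal_injective
    simpa [Complex.mul_conj'] using h
  rw [Fintype.sum_eq_zero_iff_of_nonneg (fun _ => by positivity)] at h'
  have h1 := congrFun h' l
  simp only [Pi.zero_apply] at h1
  rw [Fintype.sum_eq_zero_iff_of_nonneg (fun _ => by positivity)] at h1
  have h2 := congrFun h1 i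
  simp only [Pi.zero_apply] at h2
  rw [Fintype.sum_eq_zero_iff_of_nonneg (fun _ => by positivity)] at h2
  simpa using congrFun h2 j

/-- The Bell state is pure, so every branch must factor as Bell pair times leftover, `1 ⊗ₖ χ`. The
operator norm of `χ` is at most its Frobenius norm, and the squared Frobenius norms add up to the
`(00, 00)` entry 1/2. -/
theorem sum_norm_sq_le_half_of_reduceAB_eq_bell {m n : ℕ} {ι : Type} [Fintype ι]
    (Φ : ι → Matrix (Qubit × Fin m) (Qubit × Fin n) ℂ)
    (h : reduceAB (∑ l, ketBra (vec (Φ l))) = ketBra bellKet) : ∑ l, ‖Φ l‖ ^ 2 ≤ 1 / 2 := by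
  have hxy : ∀ x y : Qubit × Qubit, ∑ l, ∑ i, ∑ j,
      Φ l (x.1, i) (x.2, j) * star (Φ l (y.1, i) (y.2, j)) =
        if x.1 = x.2 ∧ y.1 = y.2 then 1 / 2 else 0 := fun x y => by
    rw [← reduceAB_sum_ketBra_vec, h, ketBra_bellKet_apply]
  have h01 : ∀ l i j, Φ l (0, i) (1, j) = 0 :=
    eq_zero_of_sum_mul_star_eq_zero (fun l i j => Φ l (0, i) (1, j)) (by simpa using hxy (0, 1) (0, 1))
  have h10 : ∀ l i j, Φ l (1, i) (0, j) = 0 :=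
    eq_zero_of_sum_mul_star_eq_zero (fun l i j => Φ l (1, i) (0, j)) (by simpa using hxy (1, 0) (1, 0))
  -- The Bell state is orthogonal to `|00⟩ - |11⟩`: the four entries cancel.
  have hd : ∀ l i j, Φ l (0, i) (0, j) - Φ l (1, i) (1, j) = 0 := by
    refine eq_zero_of_sum_mul_star_eq_zero (fun l i j => Φ l (0, i) (0, j) - Φ l (1, i) (1, j)) ?_
    have e1 := hxy (0, 0) (0, 0)
    have e2 := hxy (0, 0) (1, 1)
    have e3 := hxy (1, 1) (0, 0)
    have e4 := hxy (1, 1) (1, 1)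
    simp only [and_self, if_true] at e1 e2 e3 e4
    simp_rw [star_sub, sub_mul, mul_sub, Finset.sum_sub_distrib]
    rw [e1, e2, e3, e4]
    norm_num
  have hΦ : ∀ l, Φ l = (1 : Matrix Qubit Qubit ℂ) ⊗ₖ Matrix.of fun i j => Φ l (0, i) (0, j) := by
    intro l
    ext ⟨x, i⟩ ⟨y, j⟩
    fin_cases x <;> fin_cases y <;>
      simp [h01, h10, sub_eq_zero.mp (hd l i j)]
  have htr : ∑ l, ∑ i, ∑ j, ‖Φ l (0, i) (0, j)‖ ^ 2 = 1 / 2 := by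
    apply Complex.ofReal_injective
    simpa [Complex.mul_conj'] using hxy (0, 0) (0, 0)
  rw [← htr]
  refine Finset.sum_le_sum fun l _ => ?_
  conv_lhs => rw [hΦ l]
  exact norm_sq_one_kronecker_le _

theorem norm_sq_le_half_of_canRestoreBell {Ψ : Matrix AliceReg BobReg ℂ}
    (h : CanRestoreBell (ketBra (vec Ψ))) : ‖Ψ‖ ^ 2 ≤ 1 / 2 := by
  obtain ⟨m, n, Λ, hΛ, hred⟩ := h
  obtain ⟨ι, _, Φ, hΦ, hle⟩ := hΛ.exists_pure_decomposition Ψ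
  rw [hΦ] at hred
  exact hle.trans (sum_norm_sq_le_half_of_reduceAB_eq_bell Φ hred)

/-! ### Restoration from a decomposition of Bob's Gram matrix -/

/-- The coefficient matrix of the unnormalized Bell pair `|00⟩ + |11⟩` on `A, B`, with a leftover
qubit in the state `|0⟩` on Bob's side. -/
def bellMatrix : Matrix (Qubit × Fin 1) (Qubit × Fin 2) ℂ :=
  Matrix.of fun x y => if x.1 = y.1 ∧ y.2 = 0 then 1 else 0

theorem bellMatrix_conjTranspose_mul_self :
    bellMatrixᴴ * bellMatrix = Matrix.diagonal fun y => if y.2 = 0 then 1 else 0 := by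
  ext ⟨i, j⟩ ⟨k, l⟩
  fin_cases i <;> fin_cases j <;> fin_cases k <;> fin_cases l <;>
    simp [bellMatrix, Matrix.mul_apply, Fintype.sum_prod_type]

theorem reduceAB_sum_ketBra_vec_bellMatrix {r : ℕ} (c : Fin r → ℝ) (hc : ∑ k, c k ^ 2 = 1 / 2) :
    reduceAB (∑ k, ketBra (vec ((c k : ℂ) • bellMatrix))) = ketBra bellKet := by
  ext x y
  have hc' : ∑ k, (c k : ℂ) * (c k : ℂ) = 1 / 2 := by
    have := congrArg Complex.ofReal hc
    simpa [sq] using this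
  rw [reduceAB_sum_ketBra_vec, ketBra_bellKet_apply, ← hc']
  by_cases h1 : x.1 = x.2 <;> by_cases h2 : y.1 = y.2 <;> simp [bellMatrix, h1, h2]

/-- With Kraus operators `c k • bellMatrix * W k * Ψ⁻¹`, Alice's completeness relation is precisely
the Gram identity. Outcome `k` leaves `c k • bellMatrix * W k`, and Bob undoes the unitary `W k`.
The weights sum to 1/2 because `bellMatrix` has squared norm 2. -/
theorem canRestoreBell_of_gram_eq {Ψ : Matrix AliceReg BobReg ℂ} (hΨ : IsUnit Ψ.det) {r : ℕ}
    (c : Fin r → ℝ) (hc : ∑ k, c k ^ 2 = 1 / 2) (W : Fin r → Matrix (Qubit × Fin 2) BobReg ℂ)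
    (hW : ∀ k, (W k)ᴴ * W k = 1) (hW' : ∀ k, W k * (W k)ᴴ = 1)
    (hG : Ψᴴ * Ψ = ∑ k, ((c k ^ 2 : ℝ) : ℂ) • ((W k)ᴴ * (bellMatrixᴴ * bellMatrix) * W k)) :
    CanRestoreBell (ketBra (vec Ψ)) := by
  let Q : Fin r → Matrix (Qubit × Fin 1) BobReg ℂ := fun k => (c k : ℂ) • (bellMatrix * W k)
  let K : Fin r → Matrix (Qubit × Fin 1) AliceReg ℂ := fun k => Q k * Ψ⁻¹
  have hQ : ∑ k, (Q k)ᴴ * Q k = Ψᴴ * Ψ := by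
    rw [hG]
    refine Finset.sum_congr rfl fun k _ => ?_
    simp only [Q, Matrix.conjTranspose_smul, Matrix.conjTranspose_mul, Matrix.smul_mul,
      Matrix.mul_smul, smul_smul, Matrix.mul_assoc, Complex.star_def, Complex.conj_ofReal]
    push_cast
    rw [sq]
  have hK : ∑ k, (K k)ᴴ * K k = 1 := by
    have h1 : ∑ k, (K k)ᴴ * K k = Ψ⁻¹ᴴ * (∑ k, (Q k)ᴴ * Q k) * Ψ⁻¹ := by
      rw [Finset.mul_sum, Finset.sum_mul]
      refine Finset.sum_congr rfl fun k _ => ?_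
      simp only [K, Matrix.conjTranspose_mul, Matrix.mul_assoc]
    rw [h1, hQ, Matrix.mul_assoc, Matrix.mul_assoc, Matrix.mul_nonsing_inv _ hΨ, Matrix.mul_one,
      ← Matrix.conjTranspose_mul, Matrix.mul_nonsing_inv _ hΨ, Matrix.conjTranspose_one]
  have hB : ∀ k, ∑ _i : Fin 1, ((W k)ᴴᵀ)ᴴ * (W k)ᴴᵀ = 1 := by
    intro k
    have h2 := congrArg Matrix.transpose (hW k)
    rw [Matrix.transpose_one, Matrix.transpose_mul] at h2
    rw [Fin.sum_univ_one, ← h2]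
    congr 1
    ext
    simp
  refine ⟨1, 2, _, IsLOCC.alice K hK _ fun k => IsLOCC.bob (fun _ : Fin 1 => (W k)ᴴᵀ) (hB k) _
    fun _ => IsLOCC.done, ?_⟩
  rw [← reduceAB_sum_ketBra_vec_bellMatrix c hc]
  congr 1
  refine Finset.sum_congr rfl fun k _ => ?_
  rw [Fin.sum_univ_one, aliceAct_ketBra_vec, bobAct_ketBra_vec, Matrix.transpose_transpose,
    Matrix.mul_assoc (Q k), Matrix.nonsing_inv_mul _ hΨ, Matrix.mul_one, Matrix.smul_mul,
    Matrix.mul_assoc, hW' k, Matrix.mul_one]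

/-- Permuting the rows of `Uᴴ` permutes the diagonal that `U` conjugates. -/
theorem conj_submatrix_diagonal (U : Matrix BobReg BobReg ℂ) (σ : Equiv.Perm BobReg)
    (d : BobReg → ℂ) :
    (Uᴴ.submatrix σ id)ᴴ * Matrix.diagonal d * Uᴴ.submatrix σ id =
      U * Matrix.diagonal (d ∘ σ.symm) * Uᴴ := by
  have hd : Matrix.diagonal d = (Matrix.diagonal (d ∘ σ.symm)).submatrix σ σ := by
    rw [Matrix.submatrix_diagonal_equiv]
    congr 1
    ext x
    simp
  rw [hd, Matrix.conjTranspose_submatrix, Matrix.conjTranspose_conjTranspose,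
    Matrix.submatrix_mul_equiv, Matrix.submatrix_mul_equiv]
  rfl

/-- Restoration is possible when all Schmidt coefficients `p` are at most `1/2`; the inequalities
say that this holds for `p (0, 0)`, and that `p` is suitably ordered. -/
theorem canRestoreBell_of_gram_eq_diagonal {Ψ : Matrix AliceReg BobReg ℂ} (hΨ : IsUnit Ψ.det)
    (U : Matrix BobReg BobReg ℂ) (hU : U * Uᴴ = 1) (p : BobReg → ℝ)
    (hG : Ψᴴ * Ψ = U * Matrix.diagonal (fun x => (p x : ℂ)) * Uᴴ)
    (hsum : p (0, 0) + p (0, 1) + p (1, 0) + p (1, 1) = 1) (ha : p (0, 0) ≤ 1 / 2)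
    (hd : 0 ≤ p (1, 1)) (hb : p (0, 1) + p (1, 1) ≤ p (0, 0) + p (1, 0))
    (hc : p (1, 0) + p (1, 1) ≤ p (0, 0) + p (0, 1)) : CanRestoreBell (ketBra (vec Ψ)) := by
  -- The four terms have supports {00, 11}, {00, 01}, {00, 10} and {01, 10}; the weights solve the
  -- linear system that makes them add up to `p`. Each `σ k` carries the support {00, 10} of
  -- `bellMatrixᴴ * bellMatrix` to the required pair.
  let w : Fin 4 → ℝ := ![p (1, 1), ((p (0, 0) + p (0, 1)) - (p (1, 0) + p (1, 1))) / 2,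
    ((p (0, 0) + p (1, 0)) - (p (0, 1) + p (1, 1))) / 2, (1 - 2 * p (0, 0)) / 2]
  let σ : Fin 4 → Equiv.Perm BobReg :=
    ![Equiv.swap (1, 0) (1, 1), Equiv.swap (0, 1) (1, 0), 1, Equiv.swap (0, 0) (0, 1)]
  have hw : ∀ k, √(w k) ^ 2 = w k := by
    intro k
    refine Real.sq_sqrt ?_
    fin_cases k <;> simp [w] <;> linarith
  have hU' : Uᴴ * U = 1 := mul_eq_one_comm.mp hU
  refine canRestoreBell_of_gram_eq hΨ (fun k => √(w k)) ?_ (fun k => Uᴴ.submatrix (σ k) id) ?_ ?_ ?_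
  · simp_rw [hw]
    simp only [w, Fin.sum_univ_four, Matrix.cons_val]
    linarith
  · intro k
    have h := conj_submatrix_diagonal U (σ k) fun _ => 1
    have h1 : ((fun _ => 1 : BobReg → ℂ) ∘ (σ k).symm) = fun _ => 1 := rfl
    rwa [h1, Matrix.diagonal_one, Matrix.mul_one, Matrix.mul_one, hU] at h
  · intro k
    rw [Matrix.conjTranspose_submatrix, Matrix.conjTranspose_conjTranspose]
    have h := Matrix.submatrix_mul_equiv Uᴴ U (σ k) (Equiv.refl BobReg) (σ k)
    rw [hU', Matrix.submatrix_one_equiv] at h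
    exact h
  · simp_rw [bellMatrix_conjTranspose_mul_self, conj_submatrix_diagonal, hw]
    rw [hG]
    have hdist : ∀ k, ((w k : ℝ) : ℂ) •
        (U * Matrix.diagonal ((fun y : BobReg => if y.2 = 0 then (1 : ℂ) else 0) ∘ (σ k).symm) * Uᴴ)
        = U * ((w k : ℂ) • Matrix.diagonal
          ((fun y : BobReg => if y.2 = 0 then (1 : ℂ) else 0) ∘ (σ k).symm)) * Uᴴ := fun k => by
      rw [Matrix.mul_smul, Matrix.smul_mul]
    rw [Finset.sum_congr rfl fun k _ => hdist k, ← Finset.sum_mul, ← Finset.mul_sum]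
    congr 2
    ext x y
    have hsum' := congrArg Complex.ofReal hsum
    push_cast at hsum'
    by_cases hxy : x = y
    · subst hxy
      rw [Matrix.sum_apply, Fin.sum_univ_four]
      simp only [Matrix.smul_apply, Matrix.diagonal_apply_eq, Function.comp, smul_eq_mul, w, σ,
        Matrix.cons_val]
      obtain ⟨i, j⟩ := x
      fin_cases i <;> fin_cases j <;> simp [Equiv.swap_apply_def, Equiv.Perm.one_def]
      · ring
      · linear_combination hsum' / 2
      · linear_combination hsum' / 2
    · simp [Matrix.sum_apply, Matrix.diagonal_apply_ne _ hxy]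

/-! ### The conditional states -/

open scoped ComplexOrder in
/-- The spectral theorem for a two-by-two Gram matrix, with ordered eigenvalues. -/
theorem exists_gram_eq_diagonal (M : Matrix Qubit Qubit ℂ) :
    ∃ (V : Matrix Qubit Qubit ℂ) (l m : ℝ), V * Vᴴ = 1 ∧ m ≤ l ∧ 0 ≤ m ∧
      Mᴴ * M = V * Matrix.diagonal (fun i => ((![l, m] i : ℝ) : ℂ)) * Vᴴ := by
  have hA := Matrix.isHermitian_conjTranspose_mul_self M
  have hpos := Matrix.posSemidef_conjTranspose_mul_self M
  have hs := hA.spectral_theorem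
  rw [Unitary.conjStarAlgAut_apply] at hs
  have hV : (hA.eigenvectorUnitary : Matrix Qubit Qubit ℂ) * (hA.eigenvectorUnitary : Matrix _ _ ℂ)ᴴ
      = 1 := Unitary.mul_star_self_of_mem hA.eigenvectorUnitary.2
  generalize (hA.eigenvectorUnitary : Matrix Qubit Qubit ℂ) = V at hs hV
  have h0 := hpos.eigenvalues_nonneg
  generalize hA.eigenvalues = e at hs h0
  rcases le_total (e 1) (e 0) with hle | hle
  · refine ⟨V, e 0, e 1, hV, hle, h0 1, ?_⟩
    rw [hs]
    congr 3
    ext i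
    fin_cases i <;> rfl
  · refine ⟨V.submatrix id (Equiv.swap 0 1), e 1, e 0, ?_, hle, h0 0, ?_⟩
    · rw [Matrix.conjTranspose_submatrix, Matrix.submatrix_mul_equiv, hV]
      rfl
    · have hd : Matrix.diagonal (fun i => ((![e 1, e 0] i : ℝ) : ℂ)) =
          (Matrix.diagonal (RCLike.ofReal ∘ e)).submatrix (Equiv.swap 0 1) (Equiv.swap 0 1) := by
        rw [Matrix.submatrix_diagonal_equiv]
        congr 1
        ext i
        fin_cases i <;> simp
      rw [hs, hd, Matrix.conjTranspose_submatrix, Matrix.submatrix_mul_equiv,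
        Matrix.submatrix_mul_equiv]
      rfl

/-- The coefficient matrix of the link on `A, B` together with the state
`α |00⟩ + β |01⟩ + γ |10⟩` on `A', B'`. -/
def outcomeMatrix (θ α β γ : ℝ) : Matrix AliceReg BobReg ℂ :=
  Matrix.diagonal (fun i => ((![Real.cos θ, Real.sin θ] i : ℝ) : ℂ)) ⊗ₖ
    !![(α : ℂ), (β : ℂ); (γ : ℂ), 0]

theorem branchKet_hadamard (θ α β γ : ℝ) (s : Fin 2) :
    branchKet (globalKet (linkKet θ) (wKet α β γ)) (hadamardKet s) =
      ((1 / Real.sqrt 2 : ℝ) : ℂ) • vec (outcomeMatrix θ (![α, -α] s) β γ) := by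
  ext ⟨⟨i, j⟩, ⟨k, l⟩⟩
  fin_cases s <;> fin_cases i <;> fin_cases j <;> fin_cases k <;> fin_cases l <;>
    simp [branchKet, globalKet, linkKet, wKet, hadamardKet, vec, outcomeMatrix]

theorem sum_norm_sq_vec_outcomeMatrix (θ α β γ : ℝ) :
    ∑ x, ‖vec (outcomeMatrix θ α β γ) x‖ ^ 2 = α ^ 2 + β ^ 2 + γ ^ 2 := by
  simp [Fintype.sum_prod_type, vec, outcomeMatrix, mul_pow, -Complex.ofReal_cos,
    -Complex.ofReal_sin]
  have := Real.sin_sq_add_cos_sq θ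
  linear_combination (α ^ 2 + β ^ 2 + γ ^ 2) * this

theorem inv_sqrt_two_sq : (1 / Real.sqrt 2) ^ 2 = (1 / 2 : ℝ) := by
  rw [div_pow, Real.sq_sqrt (by norm_num), one_pow]

theorem branchProb_hadamard (θ α β γ : ℝ) (hnorm : α ^ 2 + β ^ 2 + γ ^ 2 = 1) (s : Fin 2) :
    branchProb (globalKet (linkKet θ) (wKet α β γ)) (hadamardKet s) = 1 / 2 := by
  have h : (![α, -α] s) ^ 2 = α ^ 2 := by fin_cases s <;> simp
  rw [branchProb, branchKet_hadamard]
  simp_rw [Pi.smul_apply, norm_smul, mul_pow, ← Finset.mul_sum]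
  rw [sum_norm_sq_vec_outcomeMatrix, h, hnorm, Complex.norm_real, Real.norm_eq_abs, sq_abs,
    inv_sqrt_two_sq, mul_one]

theorem conditionalState_hadamard (θ α β γ : ℝ) (hnorm : α ^ 2 + β ^ 2 + γ ^ 2 = 1) (s : Fin 2) :
    conditionalState (globalKet (linkKet θ) (wKet α β γ)) (hadamardKet s) =
      ketBra (vec (outcomeMatrix θ (![α, -α] s) β γ)) := by
  rw [conditionalState, branchProb_hadamard θ α β γ hnorm, branchKet_hadamard, ketBra_smul,
    inv_sqrt_two_sq, smul_smul]
  norm_num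

theorem exists_gram_outcomeMatrix (θ α β γ : ℝ) (hnorm : α ^ 2 + β ^ 2 + γ ^ 2 = 1) :
    ∃ (U : Matrix BobReg BobReg ℂ) (l m : ℝ), U * Uᴴ = 1 ∧ m ≤ l ∧ 0 ≤ m ∧ l + m = 1 ∧
      l * m = β ^ 2 * γ ^ 2 ∧
      (outcomeMatrix θ α β γ)ᴴ * outcomeMatrix θ α β γ = U * Matrix.diagonal (fun x =>
        ((![Real.cos θ ^ 2, Real.sin θ ^ 2] x.1 * ![l, m] x.2 : ℝ) : ℂ)) * Uᴴ := by
  obtain ⟨V, l, m, hV, hml, hm, hG⟩ :=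
    exists_gram_eq_diagonal !![(α : ℂ), (β : ℂ); (γ : ℂ), 0]
  have hV' : Vᴴ * V = 1 := mul_eq_one_comm.mp hV
  refine ⟨1 ⊗ₖ V, l, m, ?_, hml, hm, ?_, ?_, ?_⟩
  · rw [Matrix.conjTranspose_kronecker, ← Matrix.mul_kronecker_mul, hV, Matrix.conjTranspose_one,
      Matrix.mul_one, Matrix.one_kronecker_one]
  -- Trace and determinant of the Gram matrix determine the two eigenvalues.
  · have h := congrArg Matrix.trace hG
    rw [Matrix.trace_mul_comm (V * _), ← Matrix.mul_assoc, hV', Matrix.one_mul] at h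
    simp [Matrix.trace_fin_two, Matrix.mul_apply] at h
    norm_cast at h
    linarith
  · have h := congrArg Matrix.det hG
    rw [Matrix.det_mul_comm (V * _), ← Matrix.mul_assoc, hV', Matrix.one_mul] at h
    simp [Matrix.det_conjTranspose, Matrix.det_fin_two] at h
    norm_cast at h
    linarith
  · rw [outcomeMatrix, Matrix.conjTranspose_kronecker, ← Matrix.mul_kronecker_mul, hG,
      Matrix.conjTranspose_kronecker, Matrix.conjTranspose_one]
    have hd : Matrix.diagonal (fun x : BobReg =>
        ((![Real.cos θ ^ 2, Real.sin θ ^ 2] x.1 * ![l, m] x.2 : ℝ) : ℂ)) =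
        Matrix.diagonal (fun i => ((![Real.cos θ ^ 2, Real.sin θ ^ 2] i : ℝ) : ℂ)) ⊗ₖ
          Matrix.diagonal (fun i => ((![l, m] i : ℝ) : ℂ)) := by
      rw [Matrix.diagonal_kronecker_diagonal]
      congr 1
      ext x
      rw [Complex.ofReal_mul]
    rw [hd, ← Matrix.mul_kronecker_mul, ← Matrix.mul_kronecker_mul, Matrix.one_mul, Matrix.mul_one]
    congr 1
    rw [Matrix.diagonal_conjTranspose, Matrix.diagonal_mul_diagonal]
    congr 1
    ext i
    fin_cases i <;> simp [sq, -Complex.ofReal_cos, -Complex.ofReal_sin]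

/-! ### The threshold for the link and Bank parameters -/

open scoped Matrix.Norms.L2Operator in
theorem le_norm_sq_of_gram_eq_diagonal {Ψ : Matrix AliceReg BobReg ℂ} (U : Matrix BobReg BobReg ℂ)
    (hU : U * Uᴴ = 1) (p : BobReg → ℝ) (hG : Ψᴴ * Ψ = U * Matrix.diagonal (fun x => (p x : ℂ)) * Uᴴ)
    (x : BobReg) : p x ≤ ‖Ψ‖ ^ 2 := by
  have hU' : U ∈ unitary (Matrix BobReg BobReg ℂ) :=
    Unitary.mem_iff.mpr ⟨mul_eq_one_comm.mp hU, hU⟩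
  have h : ‖Ψ‖ * ‖Ψ‖ = ‖fun x => (p x : ℂ)‖ := by
    rw [← Matrix.l2_opNorm_conjTranspose_mul_self, hG, ← Matrix.star_eq_conjTranspose,
      CStarRing.norm_mul_mem_unitary _ (Unitary.star_mem hU'), CStarRing.norm_mem_unitary_mul _ hU',
      Matrix.l2_opNorm_diagonal]
  rw [sq, h]
  calc p x ≤ ‖(p x : ℂ)‖ := by rw [Complex.norm_real]; exact le_abs_self _
    _ ≤ _ := norm_le_pi_norm (fun x => (p x : ℂ)) x

theorem isUnit_det_outcomeMatrix {θ α β γ : ℝ} (hc : Real.cos θ ≠ 0) (hs : Real.sin θ ≠ 0)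
    (hβ : β ≠ 0) (hγ : γ ≠ 0) : IsUnit (outcomeMatrix θ α β γ).det := by
  rw [outcomeMatrix, Matrix.det_kronecker, isUnit_iff_ne_zero, Matrix.det_diagonal,
    Fin.prod_univ_two, Matrix.det_fin_two_of]
  simp [-Complex.ofReal_cos, -Complex.ofReal_sin, hc, hs, hβ, hγ]

theorem canRestoreBell_outcomeMatrix_iff {θ : ℝ} (hθ : θ ∈ Set.Ioc 0 (Real.pi / 4)) {α β γ : ℝ}
    (hβ : 0 < β) (hγ : 0 < γ) (hnorm : α ^ 2 + β ^ 2 + γ ^ 2 = 1) :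
    CanRestoreBell (ketBra (vec (outcomeMatrix θ α β γ))) ↔
      1 - Real.tan θ ^ 4 ≤ 4 * β ^ 2 * γ ^ 2 := by
  have hc : 0 < Real.cos θ :=
    Real.cos_pos_of_mem_Ioo ⟨by linarith [hθ.1, Real.pi_pos], by linarith [hθ.2, Real.pi_pos]⟩
  have hs : 0 < Real.sin θ :=
    Real.sin_pos_of_pos_of_lt_pi hθ.1 (by linarith [hθ.2, Real.pi_pos])
  have hcs := Real.sin_sq_add_cos_sq θ
  have htan : Real.tan θ ^ 2 * Real.cos θ ^ 2 = Real.sin θ ^ 2 := by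
    rw [← mul_pow, Real.tan_mul_cos hc.ne']
  have hsc : Real.sin θ ^ 2 ≤ Real.cos θ ^ 2 := by
    have h2 : 0 ≤ Real.cos (2 * θ) :=
      Real.cos_nonneg_of_mem_Icc ⟨by linarith [hθ.1, Real.pi_pos], by linarith [hθ.2]⟩
    rw [Real.cos_two_mul] at h2
    linarith
  obtain ⟨U, l, m, hU, hml, hm, hlm, hprod, hG⟩ := exists_gram_outcomeMatrix θ α β γ hnorm
  -- The condition reads `l - m ≤ tan θ ^ 2`. Multiplying by `cos θ ^ 2` and using `l - m = 2 * l -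
  -- 1` gives `2 * cos θ ^ 2 * l ≤ cos θ ^ 2 + sin θ ^ 2 = 1`.
  have hiff : 1 - Real.tan θ ^ 4 ≤ 4 * β ^ 2 * γ ^ 2 ↔ Real.cos θ ^ 2 * l ≤ 1 / 2 := by
    have h1 : 4 * β ^ 2 * γ ^ 2 = 1 - (l - m) ^ 2 := by
      linear_combination (-4) * hprod + (l + m + 1) * hlm
    have h2 : 1 - Real.tan θ ^ 4 ≤ 4 * β ^ 2 * γ ^ 2 ↔ (l - m) ^ 2 ≤ (Real.tan θ ^ 2) ^ 2 := by
      rw [h1, show (Real.tan θ ^ 2) ^ 2 = Real.tan θ ^ 4 by ring]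
      constructor <;> intro h <;> linarith
    have h3 : (l - m) * Real.cos θ ^ 2 = 2 * (Real.cos θ ^ 2 * l) - Real.cos θ ^ 2 := by
      linear_combination (-Real.cos θ ^ 2) * hlm
    rw [h2, sq_le_sq₀ (by linarith) (by positivity), ← mul_le_mul_iff_left₀ (pow_pos hc 2), htan, h3]
    constructor <;> intro h <;> linarith
  rw [hiff]
  constructor
  · intro h
    have h1 := le_norm_sq_of_gram_eq_diagonal U hU _ hG (0, 0)
    exact h1.trans (norm_sq_le_half_of_canRestoreBell h)
  · intro h
    refine canRestoreBell_of_gram_eq_diagonal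
      (isUnit_det_outcomeMatrix hc.ne' hs.ne' hβ.ne' hγ.ne') U hU _ hG ?_ ?_ ?_ ?_ ?_ <;>
      simp only [Matrix.cons_val]
    · linear_combination (l + m) * hcs + hlm
    · exact h
    · positivity
    -- The two ordering conditions reduce to `m ≤ l` and, since `θ ≤ π / 4`, to `sin θ ^ 2 ≤ cos θ ^
    -- 2`.
    · rw [← add_mul, ← add_mul]
      exact mul_le_mul_of_nonneg_left hml (by positivity)
    · rw [← mul_add, ← mul_add]
      exact mul_le_mul_of_nonneg_right hsc (by linarith)

end AssistedTeleportation

end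

theorem mainTheorem2 (θ : ℝ) (hθ : θ ∈ Set.Ioc 0 (Real.pi / 4)) (α β γ : ℝ)
    (hα : 0 < α) (hβ : 0 < β) (hγ : 0 < γ) (hnorm : α ^ 2 + β ^ 2 + γ ^ 2 = 1) :
    AssistedTeleportation.BankMeasuresRestorable
        (AssistedTeleportation.globalKet (AssistedTeleportation.linkKet θ)
          (AssistedTeleportation.wKet α β γ))
        AssistedTeleportation.hadamardKet ↔
      1 - Real.tan θ ^ 4 ≤ 4 * β ^ 2 * γ ^ 2 := by
  -- The outcomes differ only in the sign of `α`, which the criterion does not see.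
  have hs : ∀ s : Fin 2, (![α, -α] s) ^ 2 + β ^ 2 + γ ^ 2 = 1 := by
    intro s
    fin_cases s <;> simpa using hnorm
  have key : ∀ s, AssistedTeleportation.CanRestoreBell (AssistedTeleportation.conditionalState
      (AssistedTeleportation.globalKet (AssistedTeleportation.linkKet θ)
        (AssistedTeleportation.wKet α β γ)) (AssistedTeleportation.hadamardKet s)) ↔
      1 - Real.tan θ ^ 4 ≤ 4 * β ^ 2 * γ ^ 2 := fun s => by
    rw [AssistedTeleportation.conditionalState_hadamard θ α β γ hnorm]
    exact AssistedTeleportation.canRestoreBell_outcomeMatrix_iff hθ hβ hγ (hs s)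
  constructor
  · intro h
    refine (key 0).mp (h 0 ?_)
    rw [AssistedTeleportation.branchProb_hadamard θ α β γ hnorm]
    norm_num
  · exact fun h s _ => (key s).mpr h
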